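/- Let $V$ be a finite set with $|V|=n$ and let $G^+=(V,E^+)$ be a simple graph; let $E^-$ be the set of all pairs of distinct vertices not in $E^+$ (Correlation Clustering on a complete graph with positive edges $E^+$ and negative edges $E^-$). The cost of a partition of $V$ into clusters is the number of positive edges between different clusters plus the number of negative edges inside clusters, and $\mathrm{OPT}$ is the minimum cost of a partition. Write $\deg^+(v)$ for the degree of $v$ in $G^+$. Let $\beta\ge 1$ and let $d$ be a $\beta$-level predictor, i.e. numbers $d_{uv}=d_{vu}\in[0,1]$ for $u\ne v$ that satisfy $d_{uw}\le d_{uv}+d_{vw}$ and $$\sum_{\{u,v\}\in E^+}d_{uv}+\sum_{\{u,v\}\in E^-}(1-d_{uv})\le\beta\cdot\mathrm{OPT}.$$ Put $p_{uv}=f^+(d_{uv})$ if $\{u,v\}\in E^+$ and $p_{uv}=d_{uv}$ if $\{u,v\}\in E^-$, where $f^+(x)=0$ for $x<a$, $f^+(x)=\left(\frac{x-a}{b-a}\right)^2$ for $a\le x\le b$, $f^+(x)=1$ for $x>b$, with $a=0.19$ and $b=0.5095$. Let $c>0$ and $\varepsilon\in(0,1/4)$. Algorithm PairwiseDiss draws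 a uniformly random order of $V$ and starts with all vertices unclustered. In iteration $t=1,\dots,n$, let $u$ be the $t$-th vertex. First, every unclustered vertex $v$ with $\deg^+(v)\ge\ell_t:=\frac{c}{\varepsilon}\cdot\frac{n\log n}{t}$ creates a singleton cluster. Let $U^{(t)}$ be the set of vertices that are then still unclustered. If $u\in U^{(t)}$, then $u$ becomes a pivot and creates a pivot cluster $S^{(t)}$ consisting of $u$ and of each $v\in U^{(t)}\setminus\{u\}$ independently with probability $1-p_{uv}$. The cost $P^{(t)}$ of this pivot cluster is the number of positive edges between $S^{(t)}$ and $U^{(t)}\setminus S^{(t)}$ plus the number of negative edges inside $S^{(t)}$. Let $P$ be the sum of $P^{(t)}$ over all iterations $t$ that create a pivot cluster. Then $$\mathbb{E}[P]\le 2.06\,\beta\cdot\mathrm{OPT}.$$ -/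

import Mathlib

open scoped ENNReal

noncomputable section

namespace CorrClust

theorem sum_weights {V : Type*} [DecidableEq V] (A : Finset V) (q : V → unitInterval) :
    ∑ S ∈ A.powerset, (∏ v ∈ S, ENNReal.ofReal (q v : ℝ)) *
      ∏ v ∈ A \ S, ENNReal.ofReal (1 - (q v : ℝ)) = 1 := by
  rw [← Finset.prod_add]
  refine Finset.prod_eq_one fun v _ => ?_
  rw [← ENNReal.ofReal_add (q v).2.1 (sub_nonneg.2 (q v).2.2)]
  simp

variable {V : Type*} [Fintype V] [DecidableEq V]

/-- Correlation Clustering on a complete graph is given by the graph `G` of positive edges; the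
negative edges are the edges of `Gᶜ`. `cost G 𝒞` is the number of disagreements of the clustering
`𝒞`: positive edges not contained in a cluster plus negative edges contained in a cluster. -/
def cost (G : SimpleGraph V) [DecidableRel G.Adj] (𝒞 : Finpartition (Finset.univ : Finset V)) : ℕ :=
  (G.edgeFinset.filter fun e => ¬ ∃ C ∈ 𝒞.parts, e.toFinset ⊆ C).card +
    (Gᶜ.edgeFinset.filter fun e => ∃ C ∈ 𝒞.parts, e.toFinset ⊆ C).card

/-- The minimum cost of a clustering (a minimum over a nonempty set of natural numbers). -/
def opt (G : SimpleGraph V) [DecidableRel G.Adj] : ℕ :=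
  ⨅ 𝒞 : Finpartition (Finset.univ : Finset V), cost G 𝒞

/-- A predictor assigns to each unordered pair `s(u, v)` of vertices a number in `[0, 1]`. Only
its values on pairs of distinct vertices matter, so the triangle inequality is asked for pairwise
distinct vertices (it holds trivially for the others if a vertex has distance `0` to itself). -/
structure IsBetaLevel (G : SimpleGraph V) [DecidableRel G.Adj] (β : ℝ)
    (d : Sym2 V → unitInterval) : Prop where
  triangle : ∀ u v w : V, u ≠ v → v ≠ w → u ≠ w →
    (d s(u, w) : ℝ) ≤ (d s(u, v) : ℝ) + (d s(v, w) : ℝ)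
  total_le : ∑ e ∈ G.edgeFinset, (d e : ℝ) + ∑ e ∈ Gᶜ.edgeFinset, (1 - (d e : ℝ)) ≤
    β * (opt G : ℝ)

/-- The rounding function for positive edges, with `a = 0.19` and `b = 0.5095`. -/
def fPlus (x : ℝ) : ℝ :=
  if x < 0.19 then 0 else if x ≤ 0.5095 then ((x - 0.19) / (0.5095 - 0.19)) ^ 2 else 1

theorem fPlus_mem (x : ℝ) : fPlus x ∈ unitInterval := by
  unfold fPlus
  split_ifs with h1 h2
  · simp
  · have h0 : 0 ≤ (x - 0.19) / (0.5095 - 0.19) := by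
      exact div_nonneg (by linarith) (by norm_num)
    have h3 : (x - 0.19) / (0.5095 - 0.19) ≤ 1 := by
      rw [div_le_one (by norm_num)]; linarith
    exact ⟨by positivity, pow_le_one₀ h0 h3⟩
  · simp

/-- `p_{uv} = f(d_{uv})`: `f⁺(d_{uv})` on positive edges, `f⁻(d_{uv}) = d_{uv}` on negative ones. -/
def roundProb (G : SimpleGraph V) [DecidableRel G.Adj] (d : Sym2 V → unitInterval) (u v : V) :
    unitInterval :=
  if G.Adj u v then ⟨fPlus (d s(u, v)), fPlus_mem _⟩ else d s(u, v)

/-- The random subset of `A` that contains each `v ∈ A` independently with probability `q v`. -/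
def randomSubset (A : Finset V) (q : V → unitInterval) : PMF (Finset V) :=
  PMF.ofFinset
    (fun S => if S ⊆ A then (∏ v ∈ S, ENNReal.ofReal (q v : ℝ)) *
      ∏ v ∈ A \ S, ENNReal.ofReal (1 - (q v : ℝ)) else 0)
    A.powerset
    (by
      rw [← sum_weights A q]
      exact Finset.sum_congr rfl fun S hS => if_pos (Finset.mem_powerset.1 hS))
    (fun S hS => if_neg fun h => hS (Finset.mem_powerset.2 h))

/-- A record of one pivot iteration: the set `U` of vertices that were unclustered when the pivot
was marked, and the pivot cluster `S ⊆ U` that was created. -/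
structure PivotStep (V : Type*) where
  U : Finset V
  S : Finset V

/-- State of the algorithm: the unclustered vertices, the vertices that created singleton
clusters, and the pivot iterations so far (most recent first). The output clustering consists of
the sets `S` of the pivot iterations and of the singleton clusters. -/
structure State (V : Type*) where
  unclustered : Finset V
  singletons : Finset V
  pivots : List (PivotStep V)

/-- Iteration `t` of PairwiseDiss on the vertex `u`, the `t`-th one in the random order. With
`ℓ_t = (c / ε) * (n log n / t)`, each unclustered vertex of positive degree at least `ℓ_t` first
creates a singleton cluster. If `u` is still unclustered, it becomes a pivot, and each other
unclustered vertex `v` joins its cluster independently with probability `1 - p_{uv}`. -/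
def iteration (G : SimpleGraph V) [DecidableRel G.Adj] (d : Sym2 V → unitInterval) (c ε : ℝ)
    (t : ℕ) (u : V) (σ : State V) : PMF (State V) :=
  let ℓ : ℝ := c / ε * ((Fintype.card V : ℝ) * Real.log (Fintype.card V : ℝ) / (t : ℝ))
  let sing : Finset V := σ.unclustered.filter fun v => ℓ ≤ (G.degree v : ℝ)
  let U : Finset V := σ.unclustered \ sing
  if u ∈ U then
    (randomSubset (U.erase u) fun v => unitInterval.symm (roundProb G d u v)).map fun T =>
      { unclustered := U \ insert u T
        singletons := σ.singletons ∪ sing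
        pivots := ⟨U, insert u T⟩ :: σ.pivots }
  else
    PMF.pure
      { unclustered := U
        singletons := σ.singletons ∪ sing
        pivots := σ.pivots }

/-- Run the iterations `t, t + 1, …` on the vertices of a list, in this order. -/
def runFrom (G : SimpleGraph V) [DecidableRel G.Adj] (d : Sym2 V → unitInterval) (c ε : ℝ) :
    ℕ → List V → State V → PMF (State V)
  | _, [], σ => PMF.pure σ
  | t, u :: us, σ => (iteration G d c ε t u σ).bind (runFrom G d c ε (t + 1) us)

instance : Nonempty (Fin (Fintype.card V) ≃ V) := ⟨(Fintype.equivFin V).symm⟩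

/-- The distribution of the final state of PairwiseDiss: a uniformly random order `w` of the
vertices is drawn, and the iterations `1, …, n` are run from the state with all vertices
unclustered. -/
def pairwiseDiss (G : SimpleGraph V) [DecidableRel G.Adj] (d : Sym2 V → unitInterval) (c ε : ℝ) :
    PMF (State V) :=
  (PMF.uniformOfFintype (Fin (Fintype.card V) ≃ V)).bind fun w =>
    runFrom G d c ε 1 (List.ofFn w) ⟨Finset.univ, ∅, []⟩

/-- The edges of `H` decided in a pivot iteration: both endpoints were unclustered (in `U`), and
at least one of them was put into the pivot cluster `S`. -/
def decidedEdges (H : SimpleGraph V) [DecidableRel H.Adj] (s : PivotStep V) : Finset (Sym2 V) :=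
  H.edgeFinset.filter fun e => e.toFinset ⊆ s.U ∧ ¬ Disjoint e.toFinset s.S

/-- The cost induced by one pivot cluster: the decided positive edges that leave `S`, plus the
decided negative edges inside `S`. -/
def stepCost (G : SimpleGraph V) [DecidableRel G.Adj] (s : PivotStep V) : ℕ :=
  ((decidedEdges G s).filter fun e => ¬ e.toFinset ⊆ s.S).card +
    ((decidedEdges Gᶜ s).filter fun e => e.toFinset ⊆ s.S).card

/-- The total cost of the pivot clusters of a run. -/
def pivotCost (G : SimpleGraph V) [DecidableRel G.Adj] (σ : State V) : ℕ :=
  (σ.pivots.map (stepCost G)).sum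

/-- Expectation of a nonnegative random variable. -/
def expect {α : Type*} (μ : PMF α) (X : α → ℝ≥0∞) : ℝ≥0∞ := ∑' a, μ a * X a

end CorrClust

end

/-! The LP cost of an edge is $d$ if it is positive and $1-d$ if it is negative; the total is at
most $\beta\cdot\mathrm{OPT}$. The proof shows that the pivot cost so far plus 2.06 times the LP
cost of the edges between unclustered vertices (`statePotential`) does not increase in expectation.
This quantity starts at 2.06 times the total LP cost and finally bounds $P$.

Let $R$ be the set of vertices not yet drawn. It contains all unclustered vertices, and the next
vertex $u$ is uniform in $R$. The singleton step does not depend on $u$ and only discards LP cost.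
If $u\notin U$, nothing else happens. If $u\in U$, the expected change is half the sum of
`pivotTerm` over ordered pairs $v,w\in U$: expected cost of the pair minus 2.06 times its LP cost
times the probability that it is decided. Summing over $u$ gives a sum over triples. Adding the
three rotations of a triple charges a triangle with each of its vertices as pivot once
(`pivotTerm_symm_nonpos`), and this is at most 0; triples with a repeated vertex account for the
edges at the pivot. Induction over the drawn vertices finishes the proof (`sum_expect_iteration_le`,
`orderSum_expect_runFrom_le`).

What remains are numerical inequalities in three distances, one for each sign pattern. With at least
two negative edges they are short and need no triangle inequality. For `triangle_pos_pos_pos` and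
`triangle_neg_pos_pos`, distances in $[a,b]$ are written $0.19+0.3195r$, so that $f^+=r^2$ and the
sums become polynomials. Monotonicity or convexity in one side then pushes the triangle to an
extremal shape: degenerate, with two equal sides, or with a side at $b$ or 1. -/

open scoped ENNReal

noncomputable section

namespace CorrClust

/-! ### Rounding function and triangle inequalities for the four sign patterns -/

section

/-- The expected cost minus `2.06` times the expected decided LP cost of a positive edge of
LP value `x`, if its endpoints stay out of the pivot cluster with probabilities `p` and `q`. -/
def posTerm (x p q : ℝ) : ℝ := p * (1 - q) + q * (1 - p) - 2.06 * x * (1 - p * q)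

/-- The analogue of `posTerm` for a negative edge. -/
def negTerm (x p q : ℝ) : ℝ := (1 - p) * (1 - q) - 2.06 * (1 - x) * (1 - p * q)

theorem posTerm_comm (x p q : ℝ) : posTerm x p q = posTerm x q p := by
  unfold posTerm; ring

theorem negTerm_comm (x p q : ℝ) : negTerm x p q = negTerm x q p := by
  unfold negTerm; ring

theorem fPlus_of_le {x : ℝ} (h : x ≤ 0.19) : fPlus x = 0 := by
  unfold fPlus
  rcases h.lt_or_eq with h | h
  · rw [if_pos h]
  · subst h; norm_num

theorem fPlus_of_ge {x : ℝ} (h : 0.5095 ≤ x) : fPlus x = 1 := by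
  unfold fPlus
  rw [if_neg (by norm_num at h ⊢; linarith)]
  split_ifs with h1
  · rw [le_antisymm h1 h]; norm_num
  · rfl

theorem exists_fPlus_eq_sq {x : ℝ} (h1 : 0.19 ≤ x) (h2 : x ≤ 0.5095) :
    ∃ r, 0 ≤ r ∧ r ≤ 1 ∧ x = 0.19 + 0.3195 * r ∧ fPlus x = r ^ 2 := by
  refine ⟨(x - 0.19) / 0.3195, div_nonneg (by linarith) (by norm_num),
    by rw [div_le_one (by norm_num)]; linarith, by field_simp; ring, ?_⟩
  unfold fPlus
  rw [if_neg (not_lt.2 h1), if_pos h2]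
  norm_num

theorem fPlus_nonneg (x : ℝ) : 0 ≤ fPlus x := (fPlus_mem x).1

theorem fPlus_le_one (x : ℝ) : fPlus x ≤ 1 := (fPlus_mem x).2

/-- $f^+$ lies below the line through the origin and $(b,1)$. Since $2.06\,b=1.04957>1$, this gives
$f^+(x)\le 2.06x$ with some slack. -/
theorem fPlus_le {x : ℝ} (h : 0 ≤ x) : 0.5095 * fPlus x ≤ x := by
  rcases le_total x 0.19 with h1 | h1
  · rw [fPlus_of_le h1]; linarith
  rcases le_total x 0.5095 with h2 | h2
  · obtain ⟨r, h0, h3, rfl, h4⟩ := exists_fPlus_eq_sq h1 h2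
    rw [h4]; nlinarith
  · rw [fPlus_of_ge h2]; linarith

/-- A convex quadratic that is nonpositive at two points is nonpositive between them. -/
theorem quadratic_nonpos_of_convex {A B C x₀ x x₁ : ℝ} (hA : 0 ≤ A) (h0 : x₀ ≤ x) (h1 : x ≤ x₁)
    (hx₀ : A * x₀ ^ 2 + B * x₀ + C ≤ 0) (hx₁ : A * x₁ ^ 2 + B * x₁ + C ≤ 0) :
    A * x ^ 2 + B * x + C ≤ 0 := by
  rcases h0.eq_or_lt with rfl | h0
  · exact hx₀
  have key : (x₁ - x₀) * (A * x ^ 2 + B * x + C) = (x₁ - x) * (A * x₀ ^ 2 + B * x₀ + C) +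
      (x - x₀) * (A * x₁ ^ 2 + B * x₁ + C) - A * ((x - x₀) * (x₁ - x) * (x₁ - x₀)) := by ring
  have h2 : 0 ≤ A * ((x - x₀) * (x₁ - x) * (x₁ - x₀)) :=
    mul_nonneg hA (mul_nonneg (mul_nonneg (by linarith) (by linarith)) (by linarith))
  have h3 := mul_nonneg (sub_nonneg.2 h1) (neg_nonneg.2 hx₀)
  have h4 := mul_nonneg (sub_nonneg.2 h0.le) (neg_nonneg.2 hx₁)
  by_contra! h5
  have := mul_pos (show 0 < x₁ - x₀ by linarith) h5
  linarith

/-- On nonnegative reals, a quadratic with nonpositive linear coefficient is nonpositive between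
two points where it is nonpositive. -/
theorem quadratic_nonpos {A B C x₀ x x₁ : ℝ} (hB : B ≤ 0) (hn : 0 ≤ x₀) (h0 : x₀ ≤ x)
    (h1 : x ≤ x₁) (hx₀ : A * x₀ ^ 2 + B * x₀ + C ≤ 0) (hx₁ : A * x₁ ^ 2 + B * x₁ + C ≤ 0) :
    A * x ^ 2 + B * x + C ≤ 0 := by
  rcases le_total 0 A with hA | hA
  · exact quadratic_nonpos_of_convex hA h0 h1 hx₀ hx₁
  · have h2 : x₀ ^ 2 ≤ x ^ 2 := pow_le_pow_left₀ hn h0 2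
    nlinarith

/-- Writing $1-yz=(1-y)+y(1-z)$, and cyclically, shows that the decided LP cost alone already
dominates the cost; the factor 2.06 is not tight here. -/
theorem triangle_neg_neg_neg {x y z : ℝ} (hx : x ≤ 1) (hy : y ≤ 1) (hz : z ≤ 1)
    (hx0 : 0 ≤ x) (hy0 : 0 ≤ y) (hz0 : 0 ≤ z) :
    negTerm x y z + negTerm y x z + negTerm z x y ≤ 0 := by
  unfold negTerm
  have h1 : 0 ≤ (1 - x) * (1 - y) * z := by
    apply_rules [mul_nonneg] <;> linarith
  have h2 : 0 ≤ (1 - x) * (1 - z) * y := by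
    apply_rules [mul_nonneg] <;> linarith
  have h3 : 0 ≤ (1 - y) * (1 - z) * x := by
    apply_rules [mul_nonneg] <;> linarith
  have h4 : 0 ≤ (1 - x) * (1 - y) := by
    apply_rules [mul_nonneg] <;> linarith
  have h5 : 0 ≤ (1 - x) * (1 - z) := by
    apply_rules [mul_nonneg] <;> linarith
  have h6 : 0 ≤ (1 - y) * (1 - z) := by
    apply_rules [mul_nonneg] <;> linarith
  linarith

theorem triangle_pos_neg_neg {x y z : ℝ} (hx0 : 0 ≤ x) (hy : y ≤ 1) (hz : z ≤ 1)
    (hx : x ≤ 1) :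
    posTerm x y z + negTerm y (fPlus x) z + negTerm z (fPlus x) y ≤ 0 := by
  have h1 := fPlus_le hx0
  have h2 := fPlus_nonneg x
  have h3 := fPlus_le_one x
  unfold posTerm negTerm
  set p := fPlus x
  -- With $A=1-y$ and $B=1-z$, the sum is exactly $-(A+B)(0.06+2.06x-1.06p)-AB(2+4.12p-2.06x)$.
  have hc : 0 ≤ 0.06 + 2.06 * x - 1.06 * p := by linarith
  have h4 : 0 ≤ (1 - z) * (0.06 + 2.06 * x - 1.06 * p) := mul_nonneg (by linarith) hc
  have h5 : 0 ≤ (1 - y) * (0.06 + 2.06 * x - 1.06 * p) := mul_nonneg (by linarith) hc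
  have h6 : 0 ≤ (1 - y) * (1 - z) * (2 + 4.12 * p - 2.06 * x) := by
    refine mul_nonneg (mul_nonneg (by linarith) (by linarith)) ?_
    by_cases h : x ≤ 0.5095
    · linarith
    · rw [show p = 1 from fPlus_of_ge (by linarith)]; linarith
  nlinarith

/-! Triangles of positive edges -/

theorem sq_mul_one_sub_le {r : ℝ} (h0 : 0 ≤ r) : r ^ 2 * (1 - r) ≤ 4 / 27 := by
  nlinarith [mul_nonneg (by linarith : 0 ≤ r + 1 / 3) (sq_nonneg (r - 2 / 3))]

/-- This is the inequality for the positive triangle with sides $0,y,y$, where $y=0.19+0.3195s$. It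
is nearly tight around $s=0.9$, hence the squares centred there. -/
theorem two_sq_sub_le {s : ℝ} (h0 : 0 ≤ s) (h1 : s ≤ 1) :
    2 * s ^ 2 - s ^ 4 ≤ 2.06 * (0.19 + 0.3195 * s) := by
  nlinarith [sq_nonneg (s ^ 2 - 0.9 * s), sq_nonneg (s - 0.9),
    mul_nonneg h0 (sq_nonneg (s - 0.9)), mul_nonneg h0 (sub_nonneg.2 h1),
    sq_nonneg (s ^ 2 - 0.81)]

/-- The sum of the three terms of a triangle with positive edges. -/
def posTriangle (x y z p q r : ℝ) : ℝ := posTerm x q r + posTerm y p r + posTerm z p q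

theorem posTriangle_swap (x y z p q r : ℝ) :
    posTriangle x y z p q r = posTriangle y x z q p r := by
  unfold posTriangle posTerm; ring

theorem posTriangle_rotate (x y z p q r : ℝ) :
    posTriangle x y z p q r = posTriangle y z x q r p := by
  unfold posTriangle posTerm; ring

/-- The sum is $2-2.06\,(x(1-s^2)+y+z)$. Inserting $z\ge b$ and $x\ge z-y\ge 0.3195(1-s)$ leaves
$2-2.06\,(1.019-0.3195\,s^2(1-s))$. By $s^2(1-s)\le 4/27$ this is at most about $-0.0016$, one of
the tight cases for the constant 2.06. -/
theorem posTriangle_low_mid_one {x s z : ℝ} (h0 : 0 ≤ s) (h1 : s ≤ 1) (hz : 0.5095 ≤ z)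
    (ht : z ≤ x + (0.19 + 0.3195 * s)) :
    posTriangle x (0.19 + 0.3195 * s) z 0 (s ^ 2) 1 ≤ 0 := by
  unfold posTriangle posTerm
  have h2 := sq_mul_one_sub_le h0
  have h3 : 0 ≤ (1 - s ^ 2) * (x - 0.3195 * (1 - s)) :=
    mul_nonneg (by nlinarith) (by linarith)
  nlinarith

theorem posTriangle_mid_mid_one {r s z : ℝ} (hr0 : 0 ≤ r) (hr1 : r ≤ 1) (hs0 : 0 ≤ s)
    (hs1 : s ≤ 1) (hz : 0.5095 ≤ z) (ht : 0.1295 ≤ 0.3195 * (r + s)) :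
    posTriangle (0.19 + 0.3195 * r) (0.19 + 0.3195 * s) z (r ^ 2) (s ^ 2) 1 ≤ 0 := by
  unfold posTriangle posTerm
  have hq0 : 0 ≤ r * s := mul_nonneg hr0 hs0
  have hq1 : r * s ≤ 1 := by nlinarith
  have hz' : 0 ≤ (z - 0.5095) * (1 - (r * s) ^ 2) := mul_nonneg (by linarith) (by nlinarith)
  have hq2 : r + s - 1 ≤ r * s := by nlinarith
  -- The sum decreases in $z$, and at $z=b$ it depends only on $\sigma=r+s$ and $q=rs$. Here
  -- $0.95043=2-2.06\,b$, $0.3914=2.06\cdot0.19$ and $0.65817=2.06\cdot0.3195$; the bound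
  -- $\sigma-1\le q$ is $(1-r)(1-s)\ge0$.
  have main : ∀ σ q : ℝ, 0 ≤ q → σ - 1 ≤ q → 0.1295 ≤ 0.3195 * σ → σ ≤ 2 →
      0.95043 * (1 - q ^ 2) - 0.3914 * (2 - σ ^ 2 + 2 * q) - 0.65817 * σ * (1 - q) ≤ 0 := by
    intro σ q h0 h1 h2 h3
    rcases le_total σ 1 with h | h
    · nlinarith [mul_nonneg h0 (sub_nonneg.2 h), mul_nonneg (sub_nonneg.2 h) (sub_nonneg.2 h2)]
    · obtain ⟨w, rfl⟩ : ∃ w, q = σ - 1 + w := ⟨q - (σ - 1), by ring⟩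
      have hw : 0 ≤ w := by linarith
      nlinarith [mul_nonneg hw (sub_nonneg.2 h), mul_nonneg (sub_nonneg.2 h) (sub_nonneg.2 h3)]
  have := main (r + s) (r * s) hq0 hq2 (by linarith) (by linarith)
  nlinarith

theorem posTriangle_low_low_mid {x y t : ℝ} (h0 : 0 ≤ t) (h1 : t ≤ 1)
    (ht : 0.19 + 0.3195 * t ≤ x + y) :
    posTriangle x y (0.19 + 0.3195 * t) 0 0 (t ^ 2) ≤ 0 := by
  unfold posTriangle posTerm
  nlinarith

/-- The sum decreases in $x$, so $x$ may be lowered to the degenerate value $0.3195(t-s)$. Up to a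
nonpositive cubic term the result is a convex quadratic in $t$. At $t=s$ it is handled by
`two_sq_sub_le`, at $t=1$ by `sq_mul_one_sub_le`. -/
theorem posTriangle_low_mid_mid {x s t : ℝ} (hs0 : 0 ≤ s) (hst : s ≤ t)
    (ht1 : t ≤ 1) (ht : 0.3195 * t ≤ x + 0.3195 * s) :
    posTriangle x (0.19 + 0.3195 * s) (0.19 + 0.3195 * t) 0 (s ^ 2) (t ^ 2) ≤ 0 := by
  have hs1 : s ≤ 1 := hst.trans ht1
  have ht0 : 0 ≤ t := hs0.trans hst
  have hst1 : (s * t) ^ 2 ≤ 1 := pow_le_one₀ (mul_nonneg hs0 ht0) (by nlinarith)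
  have hx : 0 ≤ (x - 0.3195 * (t - s)) * (1 - (s * t) ^ 2) :=
    mul_nonneg (by linarith) (by linarith)
  have hcub : 0 ≤ s ^ 2 * ((t - s) * (1 - t ^ 2)) :=
    mul_nonneg (sq_nonneg s) (mul_nonneg (by linarith) (by nlinarith))
  have h1 := two_sq_sub_le hs0 hs1
  have h2 := sq_mul_one_sub_le hs0
  have key := quadratic_nonpos_of_convex (A := 2 * (1 - s ^ 2))
    (B := -1.31634 + 0.65817 * s ^ 2) (C := 2 * s ^ 2 - 0.7828 - 0.65817 * s ^ 3) (x := t)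
    (by nlinarith) hst ht1 (by nlinarith) (by nlinarith)
  have e : posTriangle x (0.19 + 0.3195 * s) (0.19 + 0.3195 * t) 0 (s ^ 2) (t ^ 2) =
      (2 * (1 - s ^ 2) * t ^ 2 + (-1.31634 + 0.65817 * s ^ 2) * t +
        (2 * s ^ 2 - 0.7828 - 0.65817 * s ^ 3)) -
      2.06 * ((x - 0.3195 * (t - s)) * (1 - (s * t) ^ 2)) -
      0.65817 * (s ^ 2 * ((t - s) * (1 - t ^ 2))) := by
    unfold posTriangle posTerm; ring
  rw [e]
  linarith

/-- For fixed $s$ the sum is a quadratic in $r$ with nonpositive linear coefficient, so only $r=0$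
and the equilateral case $r=s$ matter; in the latter the factor $1-s^2$ splits off. -/
theorem posTriangle_mid_eq_eq {r s : ℝ} (hr0 : 0 ≤ r) (hrs : r ≤ s) (hs1 : s ≤ 1) :
    posTriangle (0.19 + 0.3195 * r) (0.19 + 0.3195 * s) (0.19 + 0.3195 * s)
      (r ^ 2) (s ^ 2) (s ^ 2) ≤ 0 := by
  have hs0 : 0 ≤ s := hr0.trans hrs
  have h1 := two_sq_sub_le hs0 hs1
  have hs4 : s ^ 4 ≤ 1 := pow_le_one₀ hs0 hs1
  have hs2 : s ^ 2 ≤ 1 := pow_le_one₀ hs0 hs1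
  have e : ∀ r : ℝ, posTriangle (0.19 + 0.3195 * r) (0.19 + 0.3195 * s) (0.19 + 0.3195 * s)
      (r ^ 2) (s ^ 2) (s ^ 2) = (2 - 4 * s ^ 2 + 4.12 * (0.19 + 0.3195 * s) * s ^ 2) * r ^ 2 +
      (-0.65817 * (1 - s ^ 4)) * r + (4 * s ^ 2 - 2 * s ^ 4 - 0.3914 * (1 - s ^ 4) -
        4.12 * (0.19 + 0.3195 * s)) := by
    intro r; unfold posTriangle posTerm; ring
  have h2 : posTriangle (0.19 + 0.3195 * s) (0.19 + 0.3195 * s) (0.19 + 0.3195 * s)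
      (s ^ 2) (s ^ 2) (s ^ 2) = -(3 * (1 - s ^ 2) *
        (2.06 * (0.19 + 0.3195 * s) * (1 + s ^ 2) - 2 * s ^ 2)) := by
    unfold posTriangle posTerm; ring
  have h3 : 0 ≤ 2.06 * (0.19 + 0.3195 * s) * (1 + s ^ 2) - 2 * s ^ 2 := by
    nlinarith [mul_nonneg (sq_nonneg s) hs0, mul_nonneg hs0 (sq_nonneg (s - 1)),
      sq_nonneg (s - 1), sq_nonneg (s - 0.8)]
  rw [e]
  refine quadratic_nonpos (by linarith) le_rfl hr0 hrs (by linarith) ?_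
  rw [← e, h2]
  exact neg_nonpos.2 (mul_nonneg (by linarith) h3)

/-- The case of a degenerate triangle. -/
theorem posTriangle_mid_add {r s t : ℝ} (hr0 : 0 ≤ r) (hs0 : 0 ≤ s) (ht1 : t ≤ 1)
    (h : 0.3195 * t = 0.19 + 0.3195 * (r + s)) :
    posTriangle (0.19 + 0.3195 * r) (0.19 + 0.3195 * s) (0.19 + 0.3195 * t)
      (r ^ 2) (s ^ 2) (t ^ 2) ≤ 0 := by
  have ht0 : 0 ≤ t := by linarith
  -- Comparison with the degenerate triangle with the same longest side whose shortest side is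
  -- shrunk to $0.19$, where $f^+$ vanishes. This change does not decrease the sum: the difference
  -- is $rs$ times a nonnegative factor.
  have h0 := posTriangle_low_mid_mid (x := 0.19) (s := r + s) (t := t) (by linarith) (by linarith)
    ht1 (by linarith)
  have hq0 : 0 ≤ r * s := mul_nonneg hr0 hs0
  have ht2 : t ^ 2 ≤ 1 := pow_le_one₀ ht0 ht1
  have e : posTriangle (0.19 + 0.3195 * r) (0.19 + 0.3195 * s) (0.19 + 0.3195 * t)
      (r ^ 2) (s ^ 2) (t ^ 2) =
      posTriangle 0.19 (0.19 + 0.3195 * (r + s)) (0.19 + 0.3195 * t) 0 ((r + s) ^ 2) (t ^ 2)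
      - (r * s) * (4 * (1 - t ^ 2) + (2 - 2.06 * (0.19 + 0.3195 * t)) * (r * s) +
        2.06 * t ^ 2 * (0.38 - 0.3195 * (r + s))) := by
    unfold posTriangle posTerm; ring
  have h1 : 0 ≤ (r * s) * (4 * (1 - t ^ 2) + (2 - 2.06 * (0.19 + 0.3195 * t)) * (r * s) +
        2.06 * t ^ 2 * (0.38 - 0.3195 * (r + s))) := by
    refine mul_nonneg hq0 (add_nonneg (add_nonneg (by linarith) (mul_nonneg ?_ hq0)) ?_)
    · linarith
    · exact mul_nonneg (by positivity) (by linarith)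
  linarith

/-- As a quadratic in $t$ with nonpositive linear coefficient, the sum need only be checked at the
ends of the range: at $t=s$, and where the longest side reaches $b$ or the triangle degenerates,
whichever comes first. -/
theorem posTriangle_mid_mid_mid {r s t : ℝ} (hr0 : 0 ≤ r) (hrs : r ≤ s) (hst : s ≤ t)
    (ht1 : t ≤ 1) (ht : 0.3195 * t ≤ 0.19 + 0.3195 * (r + s)) :
    posTriangle (0.19 + 0.3195 * r) (0.19 + 0.3195 * s) (0.19 + 0.3195 * t)
      (r ^ 2) (s ^ 2) (t ^ 2) ≤ 0 := by
  have hs0 : 0 ≤ s := hr0.trans hrs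
  have hs1 : s ≤ 1 := hst.trans ht1
  have e : ∀ t : ℝ, posTriangle (0.19 + 0.3195 * r) (0.19 + 0.3195 * s) (0.19 + 0.3195 * t)
      (r ^ 2) (s ^ 2) (t ^ 2) = (2 - 2 * r ^ 2 - 2 * s ^ 2 + 2.06 * ((0.19 + 0.3195 * r) * s ^ 2 +
        (0.19 + 0.3195 * s) * r ^ 2)) * t ^ 2 + (-0.65817 * (1 - (r * s) ^ 2)) * t +
        (2 * (r ^ 2 + s ^ 2 - (r * s) ^ 2) - 2.06 * (0.19 + 0.3195 * r + (0.19 + 0.3195 * s) +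
          0.19 * (1 - (r * s) ^ 2))) := by
    intro t; unfold posTriangle posTerm; ring
  have hrs1 : (r * s) ^ 2 ≤ 1 := pow_le_one₀ (mul_nonneg hr0 hs0) (by nlinarith)
  have hss := posTriangle_mid_eq_eq hr0 hrs hs1
  rw [e] at hss ⊢
  rcases le_total 0.3195 (0.19 + 0.3195 * (r + s)) with h | h
  · refine quadratic_nonpos (by linarith) hs0 hst ht1 hss ?_
    rw [← e]
    have := posTriangle_mid_mid_one hr0 (hrs.trans hs1) hs0 hs1 (z := 0.19 + 0.3195 * 1)
      (by norm_num) (by linarith)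
    simpa using this
  · refine quadratic_nonpos (x₁ := 0.19 / 0.3195 + (r + s)) (by linarith) hs0 hst
      (by linarith) hss ?_
    rw [← e]
    exact posTriangle_mid_add hr0 hs0 (by linarith) (by linarith)

theorem triangle_pos_pos_pos_of_sorted {x y z : ℝ} (h0 : 0 ≤ x) (hxy : x ≤ y) (hyz : y ≤ z)
    (h : z ≤ x + y) : posTriangle x y z (fPlus x) (fPlus y) (fPlus z) ≤ 0 := by
  rcases le_total 0.5095 z with hz | hz
  · rw [fPlus_of_ge hz]
    rcases le_total 0.5095 y with hy | hy
    · rw [fPlus_of_ge hy]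
      -- The term of $x$ vanishes. The other two are $1-f^+(x)$ times $1-2.06y$ and $1-2.06z$, which
      -- are negative as $2.06\,b>1$.
      have := fPlus_le_one x
      unfold posTriangle posTerm
      nlinarith
    · rcases le_total x 0.19 with hx | hx
      · rw [fPlus_of_le hx]
        obtain ⟨s, hs0, hs1, rfl, hs⟩ := exists_fPlus_eq_sq (x := y) (by linarith) hy
        rw [hs]
        exact posTriangle_low_mid_one hs0 hs1 hz h
      · obtain ⟨s, hs0, hs1, rfl, hs⟩ := exists_fPlus_eq_sq (x := y) (by linarith) hy
        obtain ⟨r, hr0, hr1, rfl, hr⟩ := exists_fPlus_eq_sq (x := x) hx (by linarith)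
        rw [hs, hr]
        exact posTriangle_mid_mid_one hr0 hr1 hs0 hs1 hz (by linarith)
  · rcases le_total z 0.19 with hz' | hz'
    · rw [fPlus_of_le hz', fPlus_of_le (by linarith), fPlus_of_le (by linarith)]
      unfold posTriangle posTerm
      linarith
    obtain ⟨t, ht0, ht1, rfl, ht⟩ := exists_fPlus_eq_sq hz' hz
    rw [ht]
    rcases le_total y 0.19 with hy | hy
    · rw [fPlus_of_le hy, fPlus_of_le (hxy.trans hy)]
      exact posTriangle_low_low_mid ht0 ht1 h
    obtain ⟨s, hs0, hs1, rfl, hs⟩ := exists_fPlus_eq_sq hy (by linarith)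
    rw [hs]
    rcases le_total x 0.19 with hx | hx
    · rw [fPlus_of_le hx]
      exact posTriangle_low_mid_mid hs0 (by linarith) ht1 (by linarith)
    · obtain ⟨r, hr0, hr1, rfl, hr⟩ := exists_fPlus_eq_sq (x := x) hx (by linarith)
      rw [hr]
      exact posTriangle_mid_mid_mid hr0 (by linarith) (by linarith) ht1 (by linarith)

theorem triangle_pos_pos_pos {x y z : ℝ} (hx : 0 ≤ x) (hy : 0 ≤ y) (hz : 0 ≤ z)
    (h1 : x ≤ y + z) (h2 : y ≤ x + z) (h3 : z ≤ x + y) :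
    posTerm x (fPlus y) (fPlus z) + posTerm y (fPlus x) (fPlus z) +
      posTerm z (fPlus x) (fPlus y) ≤ 0 := by
  change posTriangle x y z (fPlus x) (fPlus y) (fPlus z) ≤ 0
  rcases le_total x y with hxy | hxy <;> rcases le_total y z with hyz | hyz <;>
    rcases le_total x z with hxz | hxz
  · exact triangle_pos_pos_pos_of_sorted hx hxy hyz h3
  · exact triangle_pos_pos_pos_of_sorted hx hxy hyz h3
  · rw [posTriangle_swap, posTriangle_rotate]
    exact triangle_pos_pos_pos_of_sorted hx hxz hyz h2
  · rw [posTriangle_rotate, posTriangle_rotate]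
    exact triangle_pos_pos_pos_of_sorted hz hxz hxy (by linarith)
  · rw [posTriangle_swap]
    exact triangle_pos_pos_pos_of_sorted hy hxy hxz (by linarith)
  · rw [posTriangle_rotate]
    exact triangle_pos_pos_pos_of_sorted hy hyz hxz (by linarith)
  · rw [posTriangle_swap, posTriangle_rotate, posTriangle_rotate]
    exact triangle_pos_pos_pos_of_sorted hz hyz hxy (by linarith)
  · rw [posTriangle_swap, posTriangle_rotate, posTriangle_rotate]
    exact triangle_pos_pos_pos_of_sorted hz hyz hxy (by linarith)

/-! Triangles with one negative edge -/

/-- A one-variable bound that decouples the two edges in `negTriangle_mid_mid_of_eq_one`. The number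
28 acts as a multiplier for the constraint on $i+j$, chosen so that both sides have nearly equal
slopes near the critical point $i\approx0.03$. -/
theorem one_sub_sq_mul_le {i : ℝ} (h0 : 0 ≤ i) (h1 : i ≤ 0.06) :
    i * (2 - i) * (1 / 2 + 28 * (0.03 - 0.000234 - i)) ≤ 0.04957 - 0.65817 * i := by
  nlinarith [mul_nonneg h0 (sq_nonneg (i - 0.03)), sq_nonneg (i - 0.03)]

/-- The sum of the three terms of a triangle with positive edges `y`, `z` and a negative
edge `x`. -/
def negTriangle (x y z u v : ℝ) : ℝ := negTerm x u v + posTerm y x v + posTerm z x u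

theorem negTriangle_swap (x y z u v : ℝ) : negTriangle x y z u v = negTriangle x z y v u := by
  unfold negTriangle negTerm posTerm; ring

theorem negTriangle_mid_mid_of_eq_one {s t : ℝ} (hs : s ≤ 1) (ht : t ≤ 1)
    (h : 1 ≤ 0.19 + 0.3195 * s + (0.19 + 0.3195 * t)) :
    negTriangle 1 (0.19 + 0.3195 * s) (0.19 + 0.3195 * t) (s ^ 2) (t ^ 2) ≤ 0 := by
  obtain ⟨i, rfl⟩ : ∃ i, s = 1 - i := ⟨1 - s, by ring⟩
  obtain ⟨j, rfl⟩ : ∃ j, t = 1 - j := ⟨1 - t, by ring⟩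
  have hA : 0 ≤ i * (2 - i) := mul_nonneg (by linarith) (by linarith)
  have hB : 0 ≤ j * (2 - j) := mul_nonneg (by linarith) (by linarith)
  -- With $A=1-s^2$ and $B=1-t^2$ the claim reads $AB\le B(0.04957-0.65817i)+A(0.04957-0.65817j)$.
  -- The two halves add up to $AB\,(1+28(0.059532-i-j))$, and the hypothesis gives $i+j\le
  -- 0.019/0.3195<0.059532$.
  have h1 := mul_le_mul_of_nonneg_left (one_sub_sq_mul_le (i := i) (by linarith) (by linarith)) hB
  have h2 := mul_le_mul_of_nonneg_left (one_sub_sq_mul_le (i := j) (by linarith) (by linarith)) hA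
  have h3 : 0 ≤ (i * (2 - i)) * (j * (2 - j)) * (0.06 - 0.000468 - i - j) :=
    mul_nonneg (mul_nonneg hA hB) (by linarith)
  unfold negTriangle negTerm posTerm
  linarith

theorem negTriangle_of_eq_one {y z : ℝ} (hy0 : 0 ≤ y) (hz0 : 0 ≤ z) (h : 1 ≤ y + z) :
    negTriangle 1 y z (fPlus y) (fPlus z) ≤ 0 := by
  have aux : ∀ y z : ℝ, 0.5095 ≤ y → negTriangle 1 y z (fPlus y) (fPlus z) ≤ 0 := by
    intro y z hy
    rw [fPlus_of_ge hy]
    have := fPlus_le_one z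
    unfold negTriangle negTerm posTerm
    nlinarith
  rcases le_total 0.5095 y with hy | hy
  · exact aux y z hy
  rcases le_total 0.5095 z with hz | hz
  · rw [negTriangle_swap]; exact aux z y hz
  obtain ⟨s, hs0, hs1, rfl, hs⟩ := exists_fPlus_eq_sq (x := y) (by linarith) hy
  obtain ⟨t, ht0, ht1, rfl, ht⟩ := exists_fPlus_eq_sq (x := z) (by linarith) hz
  rw [hs, ht]
  exact negTriangle_mid_mid_of_eq_one hs1 ht1 h

/-- This is the symmetric degenerate triangle $y=z=0.19+0.3195s$, $x=2y$. The bound on $s$ is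
$0.62/0.639$ rounded up, which is where $x=1$; there the inequality is nearly tight. -/
theorem quintic_nonpos {s : ℝ} (h0 : 0 ≤ s) (h1 : s ≤ 0.970267) :
    -1.06 + 3.06 * s ^ 4 + 2 * (0.19 + 0.3195 * s) *
      (2 - 4 * s ^ 2 - 2.06 * s ^ 4 + 4.12 * (0.19 + 0.3195 * s) * s ^ 2) ≤ 0 := by
  have hs : s ≤ 1 := by linarith
  have h2 : 0 ≤ (-1.3164 * s ^ 2 + 0.4641 * s + 1.0763) * (s - 0.523) ^ 2 :=
    mul_nonneg (by nlinarith) (sq_nonneg _)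
  -- Up to rounding, the negated quintic is $0.970267-s$ times this quartic, plus a remainder of
  -- about $0.00008$. The quartic exceeds the product in `h2` by about $0.015$. The bounds on powers
  -- of $s$ below absorb the rounding.
  have h3 : 0 ≤ 0.309107 - 0.998584 * s + 0.230815 * s ^ 2 + 1.841139 * s ^ 3
      - 1.316341 * s ^ 4 := by
    nlinarith [pow_nonneg h0 3, pow_nonneg h0 4]
  have h4 := mul_nonneg (sub_nonneg.2 h1) h3
  have p2 := pow_nonneg h0 2
  have p3 := pow_nonneg h0 3
  have p4 := pow_nonneg h0 4
  have q2 : s ^ 2 ≤ 1 := pow_le_one₀ h0 hs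
  have q3 : s ^ 3 ≤ 1 := pow_le_one₀ h0 hs
  have q4 : s ^ 4 ≤ 1 := pow_le_one₀ h0 hs
  have q5 : s ^ 5 ≤ 1 := pow_le_one₀ h0 hs
  have p5 := pow_nonneg h0 5
  linarith

theorem negTriangle_mid_mid_add {s t : ℝ} (hs0 : 0 ≤ s) (ht0 : 0 ≤ t)
    (h : 0.19 + 0.3195 * s + (0.19 + 0.3195 * t) ≤ 1) :
    negTriangle (0.19 + 0.3195 * s + (0.19 + 0.3195 * t)) (0.19 + 0.3195 * s)
      (0.19 + 0.3195 * t) (s ^ 2) (t ^ 2) ≤ 0 := by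
  have h5 := quintic_nonpos (s := (s + t) / 2) (by linarith) (by linarith)
  -- Replacing $s$ and $t$ by their mean keeps $x=y+z$ and does not decrease the sum: the difference
  -- is $((s-t)/2)^2$ times a nonnegative factor.
  have e : negTriangle (0.19 + 0.3195 * s + (0.19 + 0.3195 * t)) (0.19 + 0.3195 * s)
      (0.19 + 0.3195 * t) (s ^ 2) (t ^ 2) =
      -1.06 + 3.06 * ((s + t) / 2) ^ 4 + 2 * (0.19 + 0.3195 * ((s + t) / 2)) *
      (2 - 4 * ((s + t) / 2) ^ 2 - 2.06 * ((s + t) / 2) ^ 4 +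
        4.12 * (0.19 + 0.3195 * ((s + t) / 2)) * ((s + t) / 2) ^ 2) -
      (((s - t) / 2) ^ 2) * ((3.06 - 2.06 * (0.38 + 0.3195 * (s + t))) *
        (((s + t) / 2) ^ 2 + s * t) + (0.38 + 0.3195 * (s + t)) *
        (4 - 0.7828 + 0.65817 * (s + t))) := by
    unfold negTriangle negTerm posTerm; ring
  have h6 : 0 ≤ (((s - t) / 2) ^ 2) * ((3.06 - 2.06 * (0.38 + 0.3195 * (s + t))) *
        (((s + t) / 2) ^ 2 + s * t) + (0.38 + 0.3195 * (s + t)) *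
        (4 - 0.7828 + 0.65817 * (s + t))) := by
    refine mul_nonneg (sq_nonneg _) (add_nonneg (mul_nonneg (by linarith) (by positivity)) ?_)
    exact mul_nonneg (by linarith) (by linarith)
  linarith

theorem negTriangle_low_add {y z : ℝ} (hy0 : 0 ≤ y) (hy : y ≤ 0.19) (hz0 : 0 ≤ z)
    (h : y + z ≤ 1) : negTriangle (y + z) y z 0 (fPlus z) ≤ 0 := by
  rcases le_total z 0.19 with hz | hz
  · rw [fPlus_of_le hz]
    unfold negTriangle negTerm posTerm
    nlinarith
  rcases le_total 0.5095 z with hz' | hz'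
  · rw [fPlus_of_ge hz']
    unfold negTriangle negTerm posTerm
    nlinarith
  obtain ⟨t, ht0, ht1, rfl, ht⟩ := exists_fPlus_eq_sq hz hz'
  rw [ht]
  -- The sum equals $-1.06+x\,(2-(2-2.06y)t^2)$ with $x=y+z$. It increases in $y$, so $y=0.19$ is
  -- the worst case, and $1.6086=2-2.06\cdot0.19$.
  have h1 : (0.38 + 0.3195 * t) * (2 - 1.6086 * t ^ 2) ≤ 1.06 := by
    nlinarith [mul_nonneg ht0 (sq_nonneg (t - 0.4)), sq_nonneg (t - 0.4)]
  have h2 : 0 ≤ (0.19 - y) * t ^ 2 * (y + (0.19 + 0.3195 * t)) :=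
    mul_nonneg (mul_nonneg (by linarith) (sq_nonneg t)) (by linarith)
  have h3 : 0 ≤ (0.19 - y) * (2 - 1.6086 * t ^ 2) := mul_nonneg (by linarith) (by nlinarith)
  unfold negTriangle negTerm posTerm
  linarith

/-- For fixed $s$ the sum is a convex quadratic in $x=y+z$. At the lower end $z=b$ it is the case
$t=1$ of `negTriangle_mid_mid_add`; at the upper end $x=1$ it factors. -/
theorem negTriangle_mid_high_add {s z : ℝ} (hs0 : 0 ≤ s) (hs1 : s ≤ 1) (hz : 0.5095 ≤ z)
    (h : 0.19 + 0.3195 * s + z ≤ 1) :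
    negTriangle (0.19 + 0.3195 * s + z) (0.19 + 0.3195 * s) z (s ^ 2) 1 ≤ 0 := by
  have h1 := negTriangle_mid_mid_add (s := s) (t := 1) hs0 zero_le_one (by linarith)
  have e : ∀ z : ℝ, negTriangle (0.19 + 0.3195 * s + z) (0.19 + 0.3195 * s) z (s ^ 2) 1 =
      2.06 * s ^ 2 * (0.19 + 0.3195 * s + z) ^ 2 + (2.06 * (0.19 + 0.3195 * s) * (1 - s ^ 2)
        - 4.06 * s ^ 2) * (0.19 + 0.3195 * s + z) + (3.06 * s ^ 2 - 1.06) := by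
    intro z; unfold negTriangle negTerm posTerm; ring
  rw [e]
  refine quadratic_nonpos_of_convex (x₀ := 0.19 + 0.3195 * s + 0.5095) (x₁ := 1) (by positivity)
    (by linarith) h ?_ ?_
  · rw [← e]
    norm_num at h1 ⊢
    exact h1
  · have : 0 ≤ (1 - s ^ 2) * (1.06 - 2.06 * (0.19 + 0.3195 * s)) :=
      mul_nonneg (by nlinarith) (by linarith)
    linarith

theorem negTriangle_add {y z : ℝ} (hy0 : 0 ≤ y) (hz0 : 0 ≤ z) (h : y + z ≤ 1) :
    negTriangle (y + z) y z (fPlus y) (fPlus z) ≤ 0 := by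
  rcases le_total y 0.19 with hy | hy
  · rw [fPlus_of_le hy]; exact negTriangle_low_add hy0 hy hz0 h
  rcases le_total z 0.19 with hz | hz
  · rw [fPlus_of_le hz, negTriangle_swap, add_comm]
    exact negTriangle_low_add hz0 hz hy0 (by linarith)
  rcases le_total 0.5095 y with hy' | hy'
  · obtain ⟨t, ht0, ht1, rfl, ht⟩ := exists_fPlus_eq_sq (x := z) hz (by linarith)
    rw [ht, fPlus_of_ge hy', negTriangle_swap, add_comm]
    exact negTriangle_mid_high_add ht0 ht1 hy' (by linarith)
  obtain ⟨s, hs0, hs1, rfl, hs⟩ := exists_fPlus_eq_sq hy hy'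
  rw [hs]
  rcases le_total 0.5095 z with hz' | hz'
  · rw [fPlus_of_ge hz']
    exact negTriangle_mid_high_add hs0 hs1 hz' h
  obtain ⟨t, ht0, ht1, rfl, ht⟩ := exists_fPlus_eq_sq hz hz'
  rw [ht]
  exact negTriangle_mid_mid_add hs0 ht0 h

theorem triangle_neg_pos_pos {x y z : ℝ} (hx1 : x ≤ 1) (hy : 0 ≤ y) (hz : 0 ≤ z)
    (h1 : x ≤ y + z) :
    negTerm x (fPlus y) (fPlus z) + posTerm y x (fPlus z) + posTerm z x (fPlus y) ≤ 0 := by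
  change negTriangle x y z (fPlus y) (fPlus z) ≤ 0
  -- The sum is affine in the negative edge $x$ with slope `hK`, nonnegative by `fPlus_le`. So $x$
  -- can be raised to $\min(1,y+z)$.
  have mono : ∀ x', x ≤ x' → negTriangle x y z (fPlus y) (fPlus z) ≤
      negTriangle x' y z (fPlus y) (fPlus z) := by
    intro x' hx'
    have hu := fPlus_le hy
    have hv := fPlus_le hz
    have hu0 := fPlus_nonneg y
    have hv0 := fPlus_nonneg z
    have hu1 := fPlus_le_one y
    have hv1 := fPlus_le_one z
    unfold negTriangle negTerm posTerm
    set u := fPlus y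
    set v := fPlus z
    have h2 : 0 ≤ (1 - u) * (1 - v) := mul_nonneg (by linarith) (by linarith)
    have h3 : 0 ≤ (y - 0.5095 * u) * v := mul_nonneg (by linarith) hv0
    have h4 : 0 ≤ (z - 0.5095 * v) * u := mul_nonneg (by linarith) hu0
    have hK : 0 ≤ 2.06 * (1 - u * v) + 2 - 2 * u - 2 * v + 2.06 * (y * v + z * u) := by
      nlinarith
    nlinarith [mul_nonneg (sub_nonneg.2 hx') hK]
  rcases le_total (y + z) 1 with h | h
  · exact (mono _ h1).trans (negTriangle_add hy hz h)
  · exact (mono _ hx1).trans (negTriangle_of_eq_one hy hz h)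

end

/-! ### Real-valued expectations over random subsets, and symmetrization of triple sums -/

section

section SubsetExp

variable {V : Type*} [DecidableEq V]

/-- The expectation of `F S` for a random subset `S` of `A` that contains each `v ∈ A`
independently with probability `q v`. -/
def subsetExp (A : Finset V) (q : V → ℝ) (F : Finset V → ℝ) : ℝ :=
  ∑ S ∈ A.powerset, ((∏ v ∈ S, q v) * ∏ v ∈ A \ S, (1 - q v)) * F S

theorem subsetExp_congr {A : Finset V} {q q' : V → ℝ} {F F' : Finset V → ℝ}
    (hq : ∀ v ∈ A, q v = q' v) (hF : ∀ S ⊆ A, F S = F' S) :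
    subsetExp A q F = subsetExp A q' F' := by
  refine Finset.sum_congr rfl fun S hS => ?_
  rw [Finset.mem_powerset] at hS
  have h1 : ∏ v ∈ S, q v = ∏ v ∈ S, q' v := Finset.prod_congr rfl fun v hv => hq v (hS hv)
  have h2 : ∏ v ∈ A \ S, (1 - q v) = ∏ v ∈ A \ S, (1 - q' v) :=
    Finset.prod_congr rfl fun v hv => by rw [hq v (Finset.mem_sdiff.1 hv).1]
  rw [hF S hS, h1, h2]

theorem subsetExp_const (A : Finset V) (q : V → ℝ) (c : ℝ) :
    subsetExp A q (fun _ => c) = c := by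
  unfold subsetExp
  rw [← Finset.sum_mul, ← Finset.prod_add]
  simp

theorem subsetExp_add (A : Finset V) (q : V → ℝ) (F F' : Finset V → ℝ) :
    subsetExp A q (fun S => F S + F' S) = subsetExp A q F + subsetExp A q F' := by
  simp only [subsetExp, mul_add, Finset.sum_add_distrib]

theorem subsetExp_const_mul (A : Finset V) (q : V → ℝ) (c : ℝ) (F : Finset V → ℝ) :
    subsetExp A q (fun S => c * F S) = c * subsetExp A q F := by
  simp only [subsetExp, Finset.mul_sum]
  exact Finset.sum_congr rfl fun S _ => by ring

theorem subsetExp_sum {ι : Type*} (s : Finset ι) (A : Finset V) (q : V → ℝ)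
    (F : ι → Finset V → ℝ) :
    subsetExp A q (fun S => ∑ i ∈ s, F i S) = ∑ i ∈ s, subsetExp A q (F i) := by
  simp only [subsetExp, Finset.mul_sum]
  exact Finset.sum_comm

theorem subsetExp_insert {A : Finset V} {a : V} (ha : a ∉ A) (q : V → ℝ) (F : Finset V → ℝ) :
    subsetExp (insert a A) q F =
      q a * subsetExp A q (fun S => F (insert a S)) + (1 - q a) * subsetExp A q F := by
  unfold subsetExp
  rw [Finset.sum_powerset_insert ha, add_comm, Finset.mul_sum, Finset.mul_sum]
  congr 1
  · refine Finset.sum_congr rfl fun S hS => ?_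
    have haS : a ∉ S := fun h => ha (Finset.mem_powerset.1 hS h)
    rw [Finset.prod_insert haS, Finset.insert_sdiff_insert,
      Finset.sdiff_insert_of_notMem ha]
    ring
  · refine Finset.sum_congr rfl fun S hS => ?_
    have haS : a ∉ S := fun h => ha (Finset.mem_powerset.1 hS h)
    rw [Finset.insert_sdiff_of_notMem _ haS,
      Finset.prod_insert fun h => ha (Finset.mem_sdiff.1 h).1]
    ring

theorem subsetExp_erase {A : Finset V} {a : V} (ha : a ∈ A) (q : V → ℝ) (F : Finset V → ℝ) :
    subsetExp A q F = q a * subsetExp (A.erase a) q (fun S => F (insert a S)) +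
      (1 - q a) * subsetExp (A.erase a) q F := by
  conv_lhs => rw [← Finset.insert_erase ha]
  exact subsetExp_insert (Finset.notMem_erase a A) q F

/-- The expectation of a function that depends only on the membership of two elements. -/
theorem subsetExp_pair {A : Finset V} {v w : V} (hv : v ∈ A) (hw : w ∈ A) (hvw : v ≠ w)
    (q : V → ℝ) (F : Finset V → ℝ) (c₁ c₂ c₃ c₄ : ℝ)
    (h1 : ∀ S, v ∈ S → w ∈ S → F S = c₁) (h2 : ∀ S, v ∈ S → w ∉ S → F S = c₂)
    (h3 : ∀ S, v ∉ S → w ∈ S → F S = c₃) (h4 : ∀ S, v ∉ S → w ∉ S → F S = c₄) :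
    subsetExp A q F = q v * (q w * c₁ + (1 - q w) * c₂) +
      (1 - q v) * (q w * c₃ + (1 - q w) * c₄) := by
  have hw' : w ∈ A.erase v := Finset.mem_erase.2 ⟨hvw.symm, hw⟩
  rw [subsetExp_erase hv, subsetExp_erase hw', subsetExp_erase hw']
  have hB : ∀ S ⊆ (A.erase v).erase w, v ∉ S ∧ w ∉ S := fun S hS =>
    ⟨fun h => by simpa using hS h, fun h => by simpa using hS h⟩
  rw [subsetExp_congr (fun _ _ => rfl) fun S hS => h1 (insert v (insert w S)) (by simp) (by simp),
    subsetExp_congr (fun _ _ => rfl) fun S hS => h2 (insert v S) (by simp)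
      (by simp [hvw.symm, (hB S hS).2]),
    subsetExp_congr (fun _ _ => rfl) fun S hS => h3 (insert w S)
      (by simp [hvw, (hB S hS).1]) (by simp),
    subsetExp_congr (fun _ _ => rfl) fun S hS => h4 S (hB S hS).1 (hB S hS).2]
  simp only [subsetExp_const]

end SubsetExp

/-- A sum over triples is nonpositive if the terms become nonpositive after symmetrization. -/
theorem sum_triples_nonpos {V : Type*} (U : Finset V) (f : V → V → V → ℝ)
    (h : ∀ u ∈ U, ∀ v ∈ U, ∀ w ∈ U, f u v w + f v w u + f w u v ≤ 0) :
    ∑ u ∈ U, ∑ v ∈ U, ∑ w ∈ U, f u v w ≤ 0 := by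
  have h1 : ∑ u ∈ U, ∑ v ∈ U, ∑ w ∈ U, f v w u = ∑ u ∈ U, ∑ v ∈ U, ∑ w ∈ U, f u v w := by
    rw [Finset.sum_comm]
    exact Finset.sum_congr rfl fun v _ => Finset.sum_comm
  have h2 : ∑ u ∈ U, ∑ v ∈ U, ∑ w ∈ U, f w u v = ∑ u ∈ U, ∑ v ∈ U, ∑ w ∈ U, f u v w := by
    rw [Finset.sum_comm' (t' := U) (s' := fun _ => U) (by simp)]
    rw [Finset.sum_congr rfl fun v _ => Finset.sum_comm, Finset.sum_comm]
    exact Finset.sum_congr rfl fun v _ => Finset.sum_comm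
  have h3 : ∑ u ∈ U, ∑ v ∈ U, ∑ w ∈ U, (f u v w + f v w u + f w u v) ≤ 0 :=
    Finset.sum_nonpos fun u hu => Finset.sum_nonpos fun v hv => Finset.sum_nonpos fun w hw =>
      h u hu v hv w hw
  simp only [Finset.sum_add_distrib] at h3
  linarith

/-! ### Charging the cost of a pivot cluster to triangles -/

variable {V : Type*} [DecidableEq V] (G : SimpleGraph V) [DecidableRel G.Adj] (d : Sym2 V → unitInterval)

/-- The probability that `v` stays out of the pivot cluster of `u`. -/
def outProb (u v : V) : ℝ := if v = u then 0 else (roundProb G d u v : ℝ)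

/-- The cost of the pair `v`, `w` in the linear program. -/
def lpCost (v w : V) : ℝ :=
  if v = w then 0 else if G.Adj v w then (d s(v, w) : ℝ) else 1 - (d s(v, w) : ℝ)

/-- The cost of the pair `v`, `w` if `S` is made a cluster. -/
def pairCost (S : Finset V) (v w : V) : ℝ :=
  if v = w then 0 else if G.Adj v w then (if (v ∈ S ↔ w ∈ S) then 0 else 1)
    else if v ∈ S ∧ w ∈ S then 1 else 0

/-- The LP cost of the ordered pairs inside `U`, that is, twice the LP cost of the edges. -/
def potential (U : Finset V) : ℝ := ∑ v ∈ U, ∑ w ∈ U, lpCost G d v w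

/-- The expected cost of the pair `v`, `w` minus `2.06` times its expected decided LP cost, if
`u` is the pivot. -/
def pivotTerm (u v w : V) : ℝ :=
  if v = w then 0 else if G.Adj v w then posTerm (d s(v, w)) (outProb G d u v) (outProb G d u w)
    else negTerm (d s(v, w)) (outProb G d u v) (outProb G d u w)

variable {d}

theorem outProb_self (u : V) : outProb G d u u = 0 := if_pos rfl

theorem outProb_of_adj {u v : V} (h : G.Adj u v) : outProb G d u v = fPlus (d s(u, v)) := by
  simp [outProb, roundProb, h, h.ne']

theorem outProb_of_not_adj {u v : V} (hne : u ≠ v) (h : ¬ G.Adj u v) :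
    outProb G d u v = d s(u, v) := by
  simp [outProb, roundProb, h, hne.symm]

theorem outProb_comm (u v : V) : outProb G d u v = outProb G d v u := by
  unfold outProb roundProb
  simp only [eq_comm (a := v), G.adj_comm v u, Sym2.eq_swap (a := v)]

theorem pivotTerm_comm (u v w : V) : pivotTerm G d u v w = pivotTerm G d u w v := by
  unfold pivotTerm
  simp only [eq_comm (a := v), G.adj_comm v w, Sym2.eq_swap (a := v),
    posTerm_comm _ (outProb G d u v), negTerm_comm _ (outProb G d u v)]

theorem pivotTerm_self (u v : V) : pivotTerm G d u v v = 0 := if_pos rfl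

/-- An edge at the pivot is always decided. It costs $f^+(x)\le 2.06x$ in expectation if positive
and $1-x$ if negative. -/
theorem pivotTerm_pivot_nonpos (u v : V) : pivotTerm G d u u v ≤ 0 := by
  unfold pivotTerm
  split_ifs with h1 h2
  · exact le_rfl
  · rw [outProb_self, outProb_of_adj G h2]
    have := fPlus_le (d s(u, v)).2.1
    have := (d s(u, v)).2.1
    unfold posTerm
    linarith
  · rw [outProb_self]
    have := (d s(u, v)).2.2
    rw [outProb_of_not_adj G h1 h2]
    unfold negTerm
    linarith

theorem pivotTerm_symm_nonpos (htri : ∀ u v w : V, u ≠ v → v ≠ w → u ≠ w →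
    (d s(u, w) : ℝ) ≤ (d s(u, v) : ℝ) + (d s(v, w) : ℝ)) (u v w : V) :
    pivotTerm G d u v w + pivotTerm G d v w u + pivotTerm G d w u v ≤ 0 := by
  by_cases huv : u = v
  · subst huv
    rw [pivotTerm_self, pivotTerm_comm G u w u]
    linarith [pivotTerm_pivot_nonpos (d := d) G u w]
  by_cases hvw : v = w
  · subst hvw
    rw [pivotTerm_self, pivotTerm_comm G v u v]
    linarith [pivotTerm_pivot_nonpos (d := d) G v u]
  by_cases huw : u = w
  · subst huw
    rw [pivotTerm_self, pivotTerm_comm G u v u]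
    linarith [pivotTerm_pivot_nonpos (d := d) G u v]
  have t1 := htri u v w huv hvw huw
  have t2 := htri v w u hvw (Ne.symm huw) (Ne.symm huv)
  have t3 := htri w u v (Ne.symm huw) huv (Ne.symm hvw)
  have e1 : s(w, u) = s(u, w) := Sym2.eq_swap
  have e2 : s(v, u) = s(u, v) := Sym2.eq_swap
  have e3 : s(w, v) = s(v, w) := Sym2.eq_swap
  rw [e2, e1] at t2
  rw [e3, e1] at t3
  have b1 := (d s(u, v)).2
  have b2 := (d s(v, w)).2
  have b3 := (d s(u, w)).2
  simp only [pivotTerm, if_neg hvw, if_neg huv, if_neg (Ne.symm huw), e1, G.adj_comm w u,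
    outProb_comm G w u, outProb_comm G v u, outProb_comm G w v]
  by_cases g1 : G.Adj u v <;> by_cases g2 : G.Adj v w <;> by_cases g3 : G.Adj u w <;>
    simp only [g1, g2, g3, outProb_of_adj, outProb_of_not_adj, huv, hvw, huw, if_true, if_false,
      ne_eq, not_false_eq_true]
  · have := triangle_pos_pos_pos b1.1 b2.1 b3.1 (by linarith) (by linarith) (by linarith)
    simp only [posTerm] at this ⊢
    linarith
  · have := triangle_neg_pos_pos b3.2 b1.1 b2.1 (by linarith)
    simp only [posTerm, negTerm] at this ⊢
    linarith
  · have := triangle_neg_pos_pos b2.2 b1.1 b3.1 (by linarith)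
    simp only [posTerm, negTerm] at this ⊢
    linarith
  · have := triangle_pos_neg_neg b1.1 b2.2 b3.2 b1.2
    simp only [posTerm, negTerm] at this ⊢
    linarith
  · have := triangle_neg_pos_pos b1.2 b2.1 b3.1 (by linarith)
    simp only [posTerm, negTerm] at this ⊢
    linarith
  · have := triangle_pos_neg_neg b2.1 b1.2 b3.2 b2.2
    simp only [posTerm, negTerm] at this ⊢
    linarith
  · have := triangle_pos_neg_neg b3.1 b1.2 b2.2 b3.2
    simp only [posTerm, negTerm] at this ⊢
    linarith
  · have := triangle_neg_neg_neg b1.2 b2.2 b3.2 b1.1 b2.1 b3.1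
    simp only [negTerm] at this ⊢
    linarith

theorem sum_pivotTerm_nonpos (htri : ∀ u v w : V, u ≠ v → v ≠ w → u ≠ w →
    (d s(u, w) : ℝ) ≤ (d s(u, v) : ℝ) + (d s(v, w) : ℝ)) (U : Finset V) :
    ∑ u ∈ U, ∑ v ∈ U, ∑ w ∈ U, pivotTerm G d u v w ≤ 0 :=
  sum_triples_nonpos U _ fun u _ v _ w _ => pivotTerm_symm_nonpos G htri u v w

/-- The expected cost of a pivot cluster plus `2.06` times the LP cost that it leaves. -/
theorem subsetExp_pairCost_add_potential (U : Finset V) (u : V) :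
    subsetExp U (fun v => 1 - outProb G d u v) (fun S =>
      ∑ v ∈ U, ∑ w ∈ U, pairCost G S v w + 2.06 * potential G d (U \ S)) =
    2.06 * potential G d U + ∑ v ∈ U, ∑ w ∈ U, pivotTerm G d u v w := by
  -- By linearity each pair can be treated alone. It stays undecided exactly when both endpoints are
  -- outside $S$, so the surviving LP cost becomes an indicator term for the pair.
  have h1 : (fun S => ∑ v ∈ U, ∑ w ∈ U, pairCost G S v w + 2.06 * potential G d (U \ S)) =
      fun S => ∑ v ∈ U, ∑ w ∈ U, (pairCost G S v w +
        if v ∉ S then if w ∉ S then 2.06 * lpCost G d v w else 0 else 0) := by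
    funext S
    simp only [potential, Finset.sum_add_distrib, Finset.mul_sum, Finset.sdiff_eq_filter,
      Finset.sum_filter]
    congr 1
    refine Finset.sum_congr rfl fun v _ => ?_
    split_ifs <;> simp [Finset.mul_sum]
  rw [h1]
  simp only [subsetExp_sum, potential, Finset.mul_sum, ← Finset.sum_add_distrib]
  refine Finset.sum_congr rfl fun v hv => Finset.sum_congr rfl fun w hw => ?_
  by_cases hvw : v = w
  · simp [hvw, pairCost, lpCost, pivotTerm, subsetExp_const]
  by_cases ha : G.Adj v w
  · rw [subsetExp_pair hv hw hvw _ _ 0 1 1 (2.06 * lpCost G d v w)]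
    · simp only [lpCost, pivotTerm, posTerm, if_neg hvw, if_pos ha]; ring
    all_goals intro S hvS hwS; simp [pairCost, hvw, ha, hvS, hwS]
  · rw [subsetExp_pair hv hw hvw _ _ 1 0 0 (2.06 * lpCost G d v w)]
    · simp only [lpCost, pivotTerm, negTerm, if_neg hvw, if_neg ha]; ring
    all_goals intro S hvS hwS; simp [pairCost, hvw, ha, hvS, hwS]

theorem lpCost_nonneg (v w : V) : 0 ≤ lpCost G d v w := by
  unfold lpCost
  split_ifs
  · exact le_rfl
  · exact (d s(v, w)).2.1
  · exact sub_nonneg.2 (d s(v, w)).2.2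

theorem potential_nonneg (U : Finset V) : 0 ≤ potential G d U :=
  Finset.sum_nonneg fun v _ => Finset.sum_nonneg fun w _ => lpCost_nonneg G v w

theorem potential_mono {U U' : Finset V} (h : U ⊆ U') : potential G d U ≤ potential G d U' :=
  (Finset.sum_le_sum fun v _ => Finset.sum_le_sum_of_subset_of_nonneg h fun w _ _ =>
    lpCost_nonneg G v w).trans (Finset.sum_le_sum_of_subset_of_nonneg h fun v _ _ =>
      Finset.sum_nonneg fun w _ => lpCost_nonneg G v w)

end

/-! ### Expectations with respect to the distributions used by the algorithm -/

section

section Expect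

variable {α β : Type*}

theorem expect_pure (a : α) (X : α → ℝ≥0∞) : expect (PMF.pure a) X = X a := by
  unfold expect
  rw [tsum_eq_single a fun b hb => by rw [PMF.pure_apply_of_ne _ _ hb, zero_mul],
    PMF.pure_apply_self, one_mul]

theorem expect_bind (μ : PMF α) (f : α → PMF β) (X : β → ℝ≥0∞) :
    expect (μ.bind f) X = expect μ fun a => expect (f a) X := by
  simp only [expect, PMF.bind_apply, ← ENNReal.tsum_mul_right, ← ENNReal.tsum_mul_left]
  rw [ENNReal.tsum_comm]
  simp only [mul_assoc]

theorem expect_map (μ : PMF α) (f : α → β) (X : β → ℝ≥0∞) :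
    expect (μ.map f) X = expect μ fun a => X (f a) := by
  rw [← PMF.bind_pure_comp, expect_bind]
  simp only [Function.comp_apply, expect_pure]

theorem expect_mono (μ : PMF α) {X Y : α → ℝ≥0∞} (h : ∀ a ∈ μ.support, X a ≤ Y a) :
    expect μ X ≤ expect μ Y := by
  refine ENNReal.tsum_le_tsum fun a => ?_
  by_cases ha : μ a = 0
  · simp [ha]
  · exact mul_le_mul_right (h a ha) _

theorem expect_sum {ι : Type*} (s : Finset ι) (μ : PMF α) (X : ι → α → ℝ≥0∞) :
    expect μ (fun a => ∑ i ∈ s, X i a) = ∑ i ∈ s, expect μ (X i) := by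
  simp only [expect, Finset.mul_sum]
  exact Summable.tsum_finsetSum fun _ _ => ENNReal.summable

theorem expect_const_mul (μ : PMF α) (c : ℝ≥0∞) (X : α → ℝ≥0∞) :
    expect μ (fun a => c * X a) = c * expect μ X := by
  simp only [expect, ← ENNReal.tsum_mul_left, mul_left_comm]

theorem expect_uniformOfFintype [Fintype α] [Nonempty α] (X : α → ℝ≥0∞) :
    expect (PMF.uniformOfFintype α) X = (Fintype.card α : ℝ≥0∞)⁻¹ * ∑ a, X a := by
  simp only [expect, PMF.uniformOfFintype_apply, tsum_fintype, Finset.mul_sum]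

theorem expect_randomSubset {V : Type*} [DecidableEq V] (A : Finset V) (q : V → unitInterval)
    {F : Finset V → ℝ} (hF : ∀ S, 0 ≤ F S) :
    expect (randomSubset A q) (fun S => ENNReal.ofReal (F S)) =
      ENNReal.ofReal (subsetExp A (fun v => (q v : ℝ)) F) := by
  have h1 : ∀ S, 0 ≤ (∏ v ∈ S, (q v : ℝ)) * ∏ v ∈ A \ S, (1 - (q v : ℝ)) := fun S =>
    mul_nonneg (Finset.prod_nonneg fun v _ => (q v).2.1)
      (Finset.prod_nonneg fun v _ => sub_nonneg.2 (q v).2.2)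
  unfold expect subsetExp
  rw [tsum_eq_sum (s := A.powerset) fun S hS => by
      rw [randomSubset, PMF.ofFinset_apply_of_notMem _ _ hS, zero_mul],
    ENNReal.ofReal_sum_of_nonneg fun S _ => mul_nonneg (h1 S) (hF S)]
  refine Finset.sum_congr rfl fun S hS => ?_
  rw [randomSubset, PMF.ofFinset_apply, if_pos (Finset.mem_powerset.1 hS),
    ENNReal.ofReal_mul (h1 S),
    ENNReal.ofReal_mul (Finset.prod_nonneg fun v _ => (q v).2.1),
    ENNReal.ofReal_prod_of_nonneg fun v _ => (q v).2.1,
    ENNReal.ofReal_prod_of_nonneg fun v _ => sub_nonneg.2 (q v).2.2]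

end Expect

/-! ### Sums over orders of the vertices -/

section Orders

variable {V : Type*} [Fintype V] [DecidableEq V]

/-- The sum of `F` over the lists of `k` distinct elements of `R`. -/
def orderSum (k : ℕ) (R : Finset V) (F : List V → ℝ≥0∞) : ℝ≥0∞ :=
  ∑ f : Fin k → V, if Function.Injective f ∧ ∀ i, f i ∈ R then F (List.ofFn f) else 0

theorem orderSum_zero (R : Finset V) (F : List V → ℝ≥0∞) : orderSum 0 R F = F [] := by
  simp [orderSum, Function.injective_of_subsingleton]

/-- Splitting off the first vertex exposes the next draw as a sum over the remaining vertices, which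
is what the induction along the run needs. -/
theorem orderSum_succ (k : ℕ) (R : Finset V) (F : List V → ℝ≥0∞) :
    orderSum (k + 1) R F = ∑ u ∈ R, orderSum k (R.erase u) fun l => F (u :: l) := by
  unfold orderSum
  rw [← (Fin.consEquiv fun _ : Fin (k + 1) => V).sum_comp, Fintype.sum_prod_type,
    ← Finset.sum_subset (Finset.subset_univ R)]
  · refine Finset.sum_congr rfl fun u hu => Finset.sum_congr rfl fun f _ => ?_
    have h : (Function.Injective (Fin.cons u f : Fin (k + 1) → V) ∧
        ∀ i, (Fin.cons u f : Fin (k + 1) → V) i ∈ R) ↔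
        Function.Injective f ∧ ∀ i, f i ∈ R.erase u := by
      rw [Fin.cons_injective_iff, Fin.forall_fin_succ]
      simp only [Fin.cons_zero, Fin.cons_succ, hu, true_and, Set.mem_range, not_exists,
        Finset.mem_erase, forall_and]
      tauto
    change (if Function.Injective (Fin.cons u f : Fin (k + 1) → V) ∧
      ∀ i, (Fin.cons u f : Fin (k + 1) → V) i ∈ R then
        F (List.ofFn (Fin.cons u f : Fin (k + 1) → V)) else 0) = _
    simp only [h, List.ofFn_succ, Fin.cons_zero, Fin.cons_succ]
  · intro u _ hu
    refine Finset.sum_eq_zero fun f _ => if_neg fun h => hu ?_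
    simpa using h.2 0

theorem sum_equiv_ofFn (F : List V → ℝ≥0∞) :
    ∑ w : Fin (Fintype.card V) ≃ V, F (List.ofFn w) =
      orderSum (Fintype.card V) Finset.univ F := by
  unfold orderSum
  rw [← Finset.sum_filter]
  refine Finset.sum_bij (fun w _ => (w : Fin (Fintype.card V) → V)) ?_ ?_ ?_ ?_
  · intro w _
    simp [w.injective]
  · intro w _ w' _ h
    exact DFunLike.coe_injective h
  · intro f hf
    have h1 : Function.Injective f := by simpa using hf
    exact ⟨Equiv.ofBijective f ((Fintype.bijective_iff_injective_and_card f).2 ⟨h1, by simp⟩),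
      Finset.mem_univ _, rfl⟩
  · intro w _
    rfl

end Orders

/-! ### From edges to ordered pairs -/

variable {V : Type*} [Fintype V] [DecidableEq V]

/-- Sums over edges as sums over ordered pairs. -/
theorem sum_adj_eq_two_mul_sum_edgeFinset (H : SimpleGraph V) [DecidableRel H.Adj]
    (g : Sym2 V → ℝ) :
    ∑ v, ∑ w, (if H.Adj v w then g s(v, w) else 0) = 2 * ∑ e ∈ H.edgeFinset, g e := by
  rw [← Fintype.sum_prod_type' (f := fun v w => if H.Adj v w then g s(v, w) else 0),
    ← Finset.sum_filter, Finset.mul_sum,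
    ← Finset.sum_fiberwise_of_maps_to (g := fun x : V × V => s(x.1, x.2)) (t := H.edgeFinset)]
  · refine Finset.sum_congr rfl fun e he => ?_
    induction e with
    | h v w =>
      have hvw : H.Adj v w := by simpa using he
      have : (Finset.univ.filter fun x : V × V => H.Adj x.1 x.2).filter
          (fun x => s(x.1, x.2) = s(v, w)) = {(v, w), (w, v)} := by
        ext ⟨a, b⟩
        simp only [Finset.mem_filter, Finset.mem_univ, true_and, Sym2.eq_iff, Finset.mem_insert,
          Finset.mem_singleton, Prod.mk.injEq]
        constructor
        · exact fun h => h.2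
        · rintro (⟨rfl, rfl⟩ | ⟨rfl, rfl⟩)
          · exact ⟨hvw, .inl ⟨rfl, rfl⟩⟩
          · exact ⟨hvw.symm, .inr ⟨rfl, rfl⟩⟩
      rw [this, Finset.sum_pair (by simp [hvw.ne]), Sym2.eq_swap (a := w)]
      ring
  · intro x hx
    simpa using hx

variable (G : SimpleGraph V) [DecidableRel G.Adj] {d : Sym2 V → unitInterval}

theorem potential_univ : potential G d Finset.univ =
    2 * (∑ e ∈ G.edgeFinset, (d e : ℝ) + ∑ e ∈ Gᶜ.edgeFinset, (1 - (d e : ℝ))) := by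
  rw [mul_add, ← sum_adj_eq_two_mul_sum_edgeFinset G fun e => (d e : ℝ),
    ← sum_adj_eq_two_mul_sum_edgeFinset Gᶜ fun e => 1 - (d e : ℝ)]
  simp only [potential, ← Finset.sum_add_distrib]
  refine Finset.sum_congr rfl fun v _ => Finset.sum_congr rfl fun w _ => ?_
  by_cases h : v = w
  · simp [h, lpCost]
  · by_cases h' : G.Adj v w <;> simp [lpCost, h, h']

theorem two_mul_stepCost (U S : Finset V) :
    2 * (stepCost G ⟨U, S⟩ : ℝ) = ∑ v ∈ U, ∑ w ∈ U, pairCost G S v w := by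
  have h1 : ∑ v ∈ U, ∑ w ∈ U, pairCost G S v w =
      ∑ v, ∑ w, if v ∈ U then if w ∈ U then pairCost G S v w else 0 else 0 := by
    rw [← Finset.sum_subset (Finset.subset_univ U) (by
      intro v _ hv; simp [hv])]
    refine Finset.sum_congr rfl fun v hv => ?_
    simp [hv]
  simp only [stepCost, decidedEdges, Finset.filter_filter, Nat.cast_add, mul_add]
  rw [h1, ← Finset.sum_boole, ← Finset.sum_boole, ← sum_adj_eq_two_mul_sum_edgeFinset,
    ← sum_adj_eq_two_mul_sum_edgeFinset]
  simp only [← Finset.sum_add_distrib]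
  refine Finset.sum_congr rfl fun v _ => Finset.sum_congr rfl fun w _ => ?_
  simp only [Sym2.toFinset_mk_eq, Finset.insert_subset_iff, Finset.singleton_subset_iff,
    Finset.disjoint_insert_left, Finset.disjoint_singleton_left, pairCost,
    SimpleGraph.compl_adj]
  by_cases hvw : v = w
  · simp [hvw]
  by_cases ha : G.Adj v w <;> by_cases hv : v ∈ U <;> by_cases hw : w ∈ U <;>
    by_cases hv' : v ∈ S <;> by_cases hw' : w ∈ S <;> simp [hvw, ha, hv, hw, hv', hw']

end

/-! ### The potential along a run -/

section

variable {V : Type*} [Fintype V] [DecidableEq V] (G : SimpleGraph V) [DecidableRel G.Adj]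
  {d : Sym2 V → unitInterval}

variable (d) in
/-- The cost of the pivot clusters so far plus `2.06` times the LP cost of the undecided edges. -/
def statePotential (σ : State V) : ℝ :=
  (pivotCost G σ : ℝ) + 1.03 * potential G d σ.unclustered

theorem statePotential_nonneg (σ : State V) : 0 ≤ statePotential G d σ :=
  add_nonneg (Nat.cast_nonneg _) (mul_nonneg (by norm_num) (potential_nonneg G _))

/-- The quantity is an expectation of nonnegative numbers. Nonnegativity for each $u$ is needed to
move the sum over $u$ inside `ENNReal.ofReal`; only that sum has a favourable bound. -/
theorem potential_add_sum_pivotTerm_nonneg (U : Finset V) (u : V) :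
    0 ≤ 2.06 * potential G d U + ∑ v ∈ U, ∑ w ∈ U, pivotTerm G d u v w := by
  rw [← subsetExp_pairCost_add_potential]
  have h1 : ∀ v, 0 ≤ outProb G d u v ∧ outProb G d u v ≤ 1 := fun v => by
    unfold outProb
    split_ifs
    · norm_num
    · exact (roundProb G d u v).2
  refine Finset.sum_nonneg fun S _ => mul_nonneg (mul_nonneg
    (Finset.prod_nonneg fun v _ => by linarith [(h1 v).2])
    (Finset.prod_nonneg fun v _ => by linarith [(h1 v).1])) (add_nonneg ?_ ?_)
  · rw [← two_mul_stepCost]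
    positivity
  · exact mul_nonneg (by norm_num) (potential_nonneg G _)

/-- The expected potential after a pivot iteration. -/
theorem expect_randomSubset_statePotential {U : Finset V} {u : V} (hu : u ∈ U) (A : Finset V)
    (L : List (PivotStep V)) :
    expect (randomSubset (U.erase u) fun v => unitInterval.symm (roundProb G d u v))
      (fun T => ENNReal.ofReal (statePotential G d
        { unclustered := U \ insert u T, singletons := A, pivots := ⟨U, insert u T⟩ :: L })) =
    ENNReal.ofReal (((L.map (stepCost G)).sum : ℕ) + 1.03 * potential G d U +
      1 / 2 * ∑ v ∈ U, ∑ w ∈ U, pivotTerm G d u v w) := by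
  rw [expect_randomSubset _ _ fun T => statePotential_nonneg G _]
  congr 1
  have h := subsetExp_pairCost_add_potential (d := d) G U u
  -- The pivot stays out with probability 0, so a random subset of $U$ is `insert u T` with $T$
  -- random in `U.erase u`, as in the algorithm.
  rw [subsetExp_erase hu, outProb_self, sub_zero, one_mul, sub_self, zero_mul, add_zero] at h
  have e : subsetExp (U.erase u) (fun v => (unitInterval.symm (roundProb G d u v) : ℝ))
      (fun T => statePotential G d
        { unclustered := U \ insert u T, singletons := A, pivots := ⟨U, insert u T⟩ :: L }) =
      subsetExp (U.erase u) (fun v => 1 - outProb G d u v) (fun T =>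
        (((L.map (stepCost G)).sum : ℕ) : ℝ) + 1 / 2 *
          (∑ v ∈ U, ∑ w ∈ U, pairCost G (insert u T) v w +
            2.06 * potential G d (U \ insert u T))) := by
    refine subsetExp_congr (fun v hv => ?_) fun T _ => ?_
    · rw [unitInterval.coe_symm_eq, outProb, if_neg (Finset.ne_of_mem_erase hv)]
    · rw [statePotential, pivotCost, List.map_cons, List.sum_cons, Nat.cast_add,
        ← two_mul_stepCost]
      ring
  rw [e, subsetExp_add, subsetExp_const, subsetExp_const_mul, h]
  ring

/-- The supermartingale step, multiplied by $|R|$. Vertices of $R\setminus U$ create no pivot, and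
over $U$ the changes add up to half the sum of `pivotTerm` over triples, which is at most 0. -/
theorem sum_expect_iteration_le (htri : ∀ u v w : V, u ≠ v → v ≠ w → u ≠ w →
    (d s(u, w) : ℝ) ≤ (d s(u, v) : ℝ) + (d s(v, w) : ℝ)) (c ε : ℝ) (t : ℕ) (σ : State V)
    {R : Finset V} (hR : σ.unclustered ⊆ R) :
    ∑ u ∈ R, expect (iteration G d c ε t u σ) (fun τ => ENNReal.ofReal (statePotential G d τ)) ≤
      (R.card : ℝ≥0∞) * ENNReal.ofReal (statePotential G d σ) := by
  -- The singletons and $U$ do not depend on $u$, so $U$ is fixed while $u$ is averaged. All that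
  -- matters about the threshold $\ell_t$ is $U\subseteq$ `σ.unclustered`.
  obtain ⟨sing, U, hUσ, hit⟩ : ∃ sing U : Finset V, U ⊆ σ.unclustered ∧ ∀ u,
      iteration G d c ε t u σ = if u ∈ U then
        (randomSubset (U.erase u) fun v => unitInterval.symm (roundProb G d u v)).map fun T =>
          { unclustered := U \ insert u T, singletons := sing,
            pivots := ⟨U, insert u T⟩ :: σ.pivots }
        else PMF.pure { unclustered := U, singletons := sing, pivots := σ.pivots } :=
    ⟨_, _, Finset.sdiff_subset, fun u => rfl⟩
  have hUR : U ⊆ R := hUσ.trans hR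
  have hpot := potential_mono (d := d) G hUσ
  have hK : (0 : ℝ) ≤ (pivotCost G σ : ℝ) + 1.03 * potential G d U :=
    add_nonneg (Nat.cast_nonneg _) (mul_nonneg (by norm_num) (potential_nonneg G _))
  have hle : (pivotCost G σ : ℝ) + 1.03 * potential G d U ≤ statePotential G d σ := by
    unfold statePotential
    linarith
  have h1 : ∑ u ∈ R \ U, expect (iteration G d c ε t u σ)
      (fun τ => ENNReal.ofReal (statePotential G d τ)) =
      ((R \ U).card : ℝ≥0∞) * ENNReal.ofReal ((pivotCost G σ : ℝ) + 1.03 * potential G d U) := by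
    rw [← nsmul_eq_mul]
    refine Finset.sum_eq_card_nsmul fun u hu => ?_
    rw [hit, if_neg (Finset.mem_sdiff.1 hu).2, expect_pure]
    rfl
  have h2 : ∑ u ∈ U, expect (iteration G d c ε t u σ)
      (fun τ => ENNReal.ofReal (statePotential G d τ)) ≤
      (U.card : ℝ≥0∞) * ENNReal.ofReal ((pivotCost G σ : ℝ) + 1.03 * potential G d U) := by
    have h3 : ∀ u ∈ U, 0 ≤ (pivotCost G σ : ℝ) + 1.03 * potential G d U +
        1 / 2 * ∑ v ∈ U, ∑ w ∈ U, pivotTerm G d u v w := fun u _ => by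
      have := potential_add_sum_pivotTerm_nonneg (d := d) G U u
      have : (0 : ℝ) ≤ pivotCost G σ := Nat.cast_nonneg _
      linarith
    have h4 : ∀ u ∈ U, expect (iteration G d c ε t u σ)
        (fun τ => ENNReal.ofReal (statePotential G d τ)) =
        ENNReal.ofReal ((pivotCost G σ : ℝ) + 1.03 * potential G d U +
          1 / 2 * ∑ v ∈ U, ∑ w ∈ U, pivotTerm G d u v w) := fun u hu => by
      rw [hit, if_pos hu, expect_map]
      exact expect_randomSubset_statePotential G hu _ _
    rw [Finset.sum_congr rfl h4, ← ENNReal.ofReal_sum_of_nonneg h3, ← ENNReal.ofReal_natCast,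
      ← ENNReal.ofReal_mul (Nat.cast_nonneg _)]
    refine ENNReal.ofReal_le_ofReal ?_
    rw [Finset.sum_add_distrib, Finset.sum_const, nsmul_eq_mul, ← Finset.mul_sum]
    linarith [sum_pivotTerm_nonpos G htri U]
  calc _ = _ := (Finset.sum_sdiff hUR).symm
    _ ≤ ((R \ U).card : ℝ≥0∞) * ENNReal.ofReal ((pivotCost G σ : ℝ) + 1.03 * potential G d U) +
        (U.card : ℝ≥0∞) * ENNReal.ofReal ((pivotCost G σ : ℝ) + 1.03 * potential G d U) :=
      add_le_add h1.le h2
    _ = (R.card : ℝ≥0∞) * ENNReal.ofReal ((pivotCost G σ : ℝ) + 1.03 * potential G d U) := by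
      rw [← add_mul, ← Nat.cast_add, Finset.card_sdiff_add_card_eq_card hUR]
    _ ≤ _ := mul_le_mul_right (ENNReal.ofReal_le_ofReal hle) _

/-- The invariant of the induction: a drawn vertex either becomes a pivot, and so joins its own
cluster, or was already clustered. -/
theorem unclustered_subset_of_mem_support {c ε : ℝ} {t : ℕ} {u : V} {σ τ : State V} {R : Finset V}
    (hR : σ.unclustered ⊆ R) (h : τ ∈ (iteration G d c ε t u σ).support) :
    τ.unclustered ⊆ R.erase u := by
  unfold iteration at h
  dsimp only at h
  split_ifs at h with hu
  · obtain ⟨T, -, rfl⟩ := (PMF.mem_support_map_iff _ _ _).1 h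
    intro v hv
    simp only [Finset.mem_sdiff, Finset.mem_insert, not_or] at hv
    exact Finset.mem_erase.2 ⟨hv.2.1, hR hv.1.1⟩
  · rw [PMF.mem_support_pure_iff] at h
    subst h
    intro v hv
    exact Finset.mem_erase.2 ⟨fun e => hu (e ▸ hv), hR (Finset.mem_sdiff.1 hv).1⟩

/-- The factor $k!$ counts the orders of $R$. Working with sums over orders instead of averages
avoids conditioning on the drawn prefix. -/
theorem orderSum_expect_runFrom_le (htri : ∀ u v w : V, u ≠ v → v ≠ w → u ≠ w →
    (d s(u, w) : ℝ) ≤ (d s(u, v) : ℝ) + (d s(v, w) : ℝ)) (c ε : ℝ) (k : ℕ) :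
    ∀ (R : Finset V) (t : ℕ) (σ : State V), R.card = k → σ.unclustered ⊆ R →
      orderSum k R (fun l => expect (runFrom G d c ε t l σ) fun τ => (pivotCost G τ : ℝ≥0∞)) ≤
        (k.factorial : ℝ≥0∞) * ENNReal.ofReal (statePotential G d σ) := by
  induction k with
  | zero =>
    intro R t σ _ _
    rw [orderSum_zero, runFrom, expect_pure, Nat.factorial_zero, Nat.cast_one, one_mul,
      ← ENNReal.ofReal_natCast]
    refine ENNReal.ofReal_le_ofReal ?_
    unfold statePotential
    linarith [potential_nonneg (d := d) G σ.unclustered]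
  | succ k ih =>
    intro R t σ hk hR
    rw [orderSum_succ]
    calc _ = ∑ u ∈ R, expect (iteration G d c ε t u σ) (fun τ => orderSum k (R.erase u)
          fun l => expect (runFrom G d c ε (t + 1) l τ) fun τ => (pivotCost G τ : ℝ≥0∞)) := by
          refine Finset.sum_congr rfl fun u _ => ?_
          unfold orderSum
          rw [expect_sum]
          refine Finset.sum_congr rfl fun f _ => ?_
          split_ifs
          · exact expect_bind _ _ _
          · simp [expect]
      _ ≤ ∑ u ∈ R, expect (iteration G d c ε t u σ) (fun τ =>
          (k.factorial : ℝ≥0∞) * ENNReal.ofReal (statePotential G d τ)) :=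
          Finset.sum_le_sum fun u hu => expect_mono _ fun τ hτ =>
            ih _ _ _ (by rw [Finset.card_erase_of_mem hu, hk, Nat.add_sub_cancel])
              (unclustered_subset_of_mem_support G hR hτ)
      _ = (k.factorial : ℝ≥0∞) * ∑ u ∈ R, expect (iteration G d c ε t u σ) (fun τ =>
          ENNReal.ofReal (statePotential G d τ)) := by
          simp only [expect_const_mul, Finset.mul_sum]
      _ ≤ (k.factorial : ℝ≥0∞) * ((R.card : ℝ≥0∞) * ENNReal.ofReal (statePotential G d σ)) :=
          mul_le_mul_right (sum_expect_iteration_le G htri c ε t σ hR) _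
      _ = _ := by
          rw [hk, Nat.factorial_succ, Nat.cast_mul]
          ring

end

end CorrClust

end

theorem mainTheorem6 {V : Type*} [Fintype V] [DecidableEq V] (G : SimpleGraph V)
    [DecidableRel G.Adj] (β c ε : ℝ) (hβ : 1 ≤ β) (hc : 0 < c) (hε : 0 < ε) (hε' : ε < 1 / 4)
    (d : Sym2 V → unitInterval) (hd : CorrClust.IsBetaLevel G β d) :
    CorrClust.expect (CorrClust.pairwiseDiss G d c ε)
        (fun σ => (CorrClust.pivotCost G σ : ENNReal)) ≤
      ENNReal.ofReal (2.06 * β * (CorrClust.opt G : ℝ)) := by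
  have h := CorrClust.orderSum_expect_runFrom_le G hd.triangle c ε (Fintype.card V) Finset.univ 1
    ⟨Finset.univ, ∅, []⟩ Finset.card_univ subset_rfl
  rw [CorrClust.pairwiseDiss, CorrClust.expect_bind, CorrClust.expect_uniformOfFintype,
    CorrClust.sum_equiv_ofFn fun l => CorrClust.expect (CorrClust.runFrom G d c ε 1 l
      ⟨Finset.univ, ∅, []⟩) fun σ => (CorrClust.pivotCost G σ : ENNReal),
    Fintype.card_equiv (Fintype.equivFin V).symm, Fintype.card_fin]
  refine (mul_le_mul_right h _).trans ?_
  rw [← mul_assoc, ENNReal.inv_mul_cancel (by exact_mod_cast Nat.factorial_ne_zero _)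
    (ENNReal.natCast_ne_top _), one_mul]
  refine ENNReal.ofReal_le_ofReal ?_
  -- Initially there is no pivot cost, and the potential counts each edge twice, so the bound is
  -- $1.03\cdot2$ times the total LP cost.
  have h1 := hd.total_le
  simp only [CorrClust.statePotential, CorrClust.potential_univ, CorrClust.pivotCost,
    List.map_nil, List.sum_nil, Nat.cast_zero]
  linarith
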